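/- Let $\mathbb K$ be a field of characteristic $0$. A dendriform algebra is a $\mathbb K$-vector space $D$ with bilinear operations $\prec,\succ$ such that $(a\prec b)\prec c=a\prec(b\prec c+b\succ c)$, $(a\succ b)\prec c=a\succ(b\prec c)$ and $(a\prec b+a\succ b)\succ c=a\succ(b\succ c)$; it is involutive if it carries a linear map $*$ with $a^{**}=a$ and $(a\prec b)^*=b^*\succ a^*$. A Rota--Baxter algebra is a (nonunitary) associative algebra $A$ with a linear map $R:A\to A$ such that $R(a)R(b)=R(aR(b)+R(a)b)$; it is involutive if it carries a linear map $*$ with $a^{**}=a$, $(ab)^*=b^*a^*$ and $R(a)^*=R(a^*)$. Let $B$ be a nonunitary associative algebra with basis $X$. The Rota--Baxter words over $X$ are the non-empty finite words whose letters are alternately elements of $X$ and bracketed words $\lfloor w\rfloor$ with $w$ again a Rota--Baxter word. Let $\varpi^{\mathrm{NC},0}(B)$ be the vector space with basis all Rota--Baxter words, with $R_B(w)=\lfloor w\rfloor$ and with the bilinear product $\diamond$ given recursively on words by $$x_1\cdots x_m\diamond y_1\cdots y_n=x_1\cdots x_{m-1}(x_m\diamond y_1)y_2\cdots y_n ,$$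 where for single letters $x\diamond y$ is the product in $B$ if $x,y\in X$, the concatenation $xy$ if exactly one of $x,y$ lies in $X$, and $\lfloor u\rfloor\diamond\lfloor v\rfloor=\lfloor\lfloor u\rfloor\diamond v\rfloor+\lfloor u\diamond\lfloor v\rfloor\rfloor$. An involution of $B$ induces the linear map $*$ on $\varpi^{\mathrm{NC},0}(B)$ given by the involution of $B$ on $X$, $\lfloor w\rfloor^*=\lfloor w^*\rfloor$ and $(x_1\cdots x_m)^*=x_m^*\cdots x_1^*$ (extended multilinearly). Let $(D,\prec,\succ,*)$ be an involutive dendriform algebra, let $T(D)=\bigoplus_{n\ge1}D^{\otimes n}$ be the nonunitary tensor algebra with the involution $(v_1\otimes\cdots\otimes v_n)^*=v_n^*\otimes\cdots\otimes v_1^*$, and form $\varpi^{\mathrm{NC},0}(T(D))$ with respect to any basis of $T(D)$. Let $J_R\subset\varpi^{\mathrm{NC},0}(T(D))$ be the Rota--Baxter ideal (the smallest two-sided ideal stable under $R_{T(D)}$) generated by the elements $x\prec y-x\diamond\lfloor y\rfloor$ and $x\succ y-\lfloor x\rfloor\diamond y$ for $x,y\in D$. Then: 1. $(\varpi^{\mathrm{NC},0}(T(D)),\diamond,R_{T(D)},*)$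 is an involutive Rota--Baxter algebra; 2. $J_R$ is stable under $*$; 3. the universal enveloping Rota--Baxter algebra $\varpi^{\mathrm{NC},0}(T(D))/J_R$ of $D$, with the product and the operator induced from $\varpi^{\mathrm{NC},0}(T(D))$, inherits an involution: there is a unique linear map $*$ on it with $[z]^*=[z^*]$ for all $z\in\varpi^{\mathrm{NC},0}(T(D))$ that makes it an involutive Rota--Baxter algebra. -/

import Mathlib

noncomputable section

/-! ### Dendriform and Rota-Baxter algebras

A nonunitary algebra is a vector space with a bilinear product `μ : A →ₗ[K] A →ₗ[K] A`;
involutions are `K`-linear maps. -/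

/-- `(D, ≺, ≻)` is a dendriform algebra. -/
structure IsDendriform {K D : Type*} [Field K] [AddCommGroup D] [Module K D]
    (prec succ : D →ₗ[K] D →ₗ[K] D) : Prop where
  prec_prec : ∀ a b c, prec (prec a b) c = prec a (prec b c + succ b c)
  succ_prec : ∀ a b c, prec (succ a b) c = succ a (prec b c)
  succ_succ : ∀ a b c, succ (prec a b + succ a b) c = succ a (succ b c)

/-- `(D, ≺, ≻, *)` is an involutive dendriform algebra. -/
structure IsInvolutiveDendriform {K D : Type*} [Field K] [AddCommGroup D] [Module K D]
    (prec succ : D →ₗ[K] D →ₗ[K] D) (str : D →ₗ[K] D) : Prop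
    extends IsDendriform prec succ where
  star_star : ∀ a, str (str a) = a
  star_prec : ∀ a b, str (prec a b) = succ (str b) (str a)

/-- `(A, μ, R)` is a (nonunitary, associative) Rota-Baxter algebra (of weight zero). -/
structure IsRotaBaxterAlgebra {K A : Type*} [Field K] [AddCommGroup A] [Module K A]
    (μ : A →ₗ[K] A →ₗ[K] A) (R : A →ₗ[K] A) : Prop where
  mul_assoc : ∀ a b c, μ (μ a b) c = μ a (μ b c)
  rotaBaxter : ∀ a b, μ (R a) (R b) = R (μ a (R b) + μ (R a) b)

/-- `(A, μ, R, *)` is a (nonunitary) involutive Rota-Baxter algebra. -/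
structure IsInvolutiveRotaBaxterAlgebra {K A : Type*} [Field K] [AddCommGroup A] [Module K A]
    (μ : A →ₗ[K] A →ₗ[K] A) (R : A →ₗ[K] A) (str : A →ₗ[K] A) : Prop
    extends IsRotaBaxterAlgebra μ R where
  star_star : ∀ a, str (str a) = a
  star_mul : ∀ a b, str (μ a b) = μ (str b) (str a)
  star_op : ∀ a, str (R a) = R (str a)

/-- Rota-Baxter ideals: two-sided ideals that are stable under the operator. -/
structure IsRotaBaxterIdeal {K A : Type*} [Field K] [AddCommGroup A] [Module K A]
    (μ : A →ₗ[K] A →ₗ[K] A) (R : A →ₗ[K] A) (I : Submodule K A) : Prop where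
  mul_left_mem : ∀ a, ∀ x ∈ I, μ a x ∈ I
  mul_right_mem : ∀ a, ∀ x ∈ I, μ x a ∈ I
  op_mem : ∀ x ∈ I, R x ∈ I

/-- The Rota-Baxter ideal generated by a set. -/
def rotaBaxterIdealSpan {K A : Type*} [Field K] [AddCommGroup A] [Module K A]
    (μ : A →ₗ[K] A →ₗ[K] A) (R : A →ₗ[K] A) (S : Set A) : Submodule K A :=
  sInf {I : Submodule K A | IsRotaBaxterIdeal μ R I ∧ S ⊆ I}

theorem isRotaBaxterIdeal_span {K A : Type*} [Field K] [AddCommGroup A] [Module K A]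
    (μ : A →ₗ[K] A →ₗ[K] A) (R : A →ₗ[K] A) (S : Set A) :
    IsRotaBaxterIdeal μ R (rotaBaxterIdealSpan μ R S) := by
  refine ⟨fun a x hx => ?_, fun a x hx => ?_, fun x hx => ?_⟩ <;>
    · rw [rotaBaxterIdealSpan, Submodule.mem_sInf] at hx ⊢
      intro I hI
      first
        | exact hI.1.mul_left_mem a x (hx I hI)
        | exact hI.1.mul_right_mem a x (hx I hI)
        | exact hI.1.op_mem x (hx I hI)

/-- The product induced on the quotient by a Rota-Baxter ideal. -/
def quotientMul {K A : Type*} [Field K] [AddCommGroup A] [Module K A]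
    {μ : A →ₗ[K] A →ₗ[K] A} {R : A →ₗ[K] A} {I : Submodule K A}
    (hI : IsRotaBaxterIdeal μ R I) : (A ⧸ I) →ₗ[K] (A ⧸ I) →ₗ[K] (A ⧸ I) :=
  I.liftQ
    ((Submodule.mapQLinear I I).comp
      (μ.codRestrict (Submodule.compatibleMaps I I) fun a x hx => hI.mul_left_mem a x hx))
    (by
      intro x hx
      rw [LinearMap.mem_ker]
      ext a
      exact (Submodule.Quotient.mk_eq_zero I).2 (hI.mul_right_mem a x hx))

theorem quotientMul_mk {K A : Type*} [Field K] [AddCommGroup A] [Module K A]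
    {μ : A →ₗ[K] A →ₗ[K] A} {R : A →ₗ[K] A} {I : Submodule K A}
    (hI : IsRotaBaxterIdeal μ R I) (a b : A) :
    quotientMul hI (I.mkQ a) (I.mkQ b) = I.mkQ (μ a b) := rfl

/-- The operator induced on the quotient by a Rota-Baxter ideal. -/
def quotientOp {K A : Type*} [Field K] [AddCommGroup A] [Module K A]
    {μ : A →ₗ[K] A →ₗ[K] A} {R : A →ₗ[K] A} {I : Submodule K A}
    (hI : IsRotaBaxterIdeal μ R I) : (A ⧸ I) →ₗ[K] (A ⧸ I) :=
  I.mapQ I R fun x hx => hI.op_mem x hx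

theorem quotientOp_mk {K A : Type*} [Field K] [AddCommGroup A] [Module K A]
    {μ : A →ₗ[K] A →ₗ[K] A} {R : A →ₗ[K] A} {I : Submodule K A}
    (hI : IsRotaBaxterIdeal μ R I) (a : A) :
    quotientOp hI (I.mkQ a) = I.mkQ (R a) := rfl

/-! ### Rota-Baxter words -/

/-- Rota-Baxter words over `X` with prescribed head: words whose letters are alternately elements
of `X` and bracketed Rota-Baxter words `⌊w⌋`. The index is the head: `false` if the first letter
is in `X`, `true` if it is bracketed. -/
inductive RBWord (X : Type*) : Bool → Type _
  /-- the word `x` -/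
  | var (x : X) : RBWord X false
  /-- the word `⌊u⌋` -/
  | brak {h : Bool} (u : RBWord X h) : RBWord X true
  /-- the word `x w`, where `w` begins with a bracket -/
  | varCons (x : X) (w : RBWord X true) : RBWord X false
  /-- the word `⌊u⌋ w`, where `w` begins with an element of `X` -/
  | brakCons {h : Bool} (u : RBWord X h) (w : RBWord X false) : RBWord X true

section FreeRB

variable {K B X : Type*} [Field K] [NonUnitalRing B] [Module K B]

/-- The product `x ⋄ x'` of two Rota-Baxter words over a basis `X` of `B`, a linear combination of
words with the same head as `x`. All letters of `x` but the last and all letters of `x'` but the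
first are kept; the last letter of `x` and the first letter of `x'` are multiplied by the rules
`a ⋄ b = a · b` (product in `B`), concatenation if exactly one of them is bracketed, and
`⌊u⌋ ⋄ ⌊v⌋ = ⌊⌊u⌋ ⋄ v⌋ + ⌊u ⋄ ⌊v⌋⌋`. -/
def RBWord.mul (b : Module.Basis X K B) :
    {h h' : Bool} → RBWord X h → RBWord X h' → (RBWord X h →₀ K)
  | _, _, .varCons x w, y => (RBWord.mul b w y).mapDomain (.varCons x)
  | _, _, .brakCons u w, y => (RBWord.mul b w y).mapDomain (.brakCons u)
  | _, true, .var x, y => Finsupp.single (.varCons x y) 1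
  | _, _, .var x, .var y => (b.repr (b x * b y)).mapDomain .var
  | _, _, .var x, .varCons y w => (b.repr (b x * b y)).mapDomain fun z => .varCons z w
  | _, false, .brak u, y => Finsupp.single (.brakCons u y) 1
  | _, _, .brak u, .brak v =>
      (RBWord.mul b (.brak u) v).mapDomain .brak + (RBWord.mul b u (.brak v)).mapDomain .brak
  | _, _, .brak u, .brakCons v w =>
      (RBWord.mul b (.brak u) v).mapDomain (fun z => .brakCons z w) +
        (RBWord.mul b u (.brak v)).mapDomain (fun z => .brakCons z w)
termination_by _ _ x y => sizeOf x + sizeOf y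

/-- The vector space `ϖ^{NC,0}(B)` with basis all Rota-Baxter words over the basis `b` of `B`. -/
def FreeRB (_b : Module.Basis X K B) : Type _ := (Σ h : Bool, RBWord X h) →₀ K

instance (b : Module.Basis X K B) : AddCommGroup (FreeRB b) :=
  inferInstanceAs (AddCommGroup ((Σ h : Bool, RBWord X h) →₀ K))

instance (b : Module.Basis X K B) : Module K (FreeRB b) :=
  inferInstanceAs (Module K ((Σ h : Bool, RBWord X h) →₀ K))

namespace FreeRB

/-- The basis of `ϖ^{NC,0}(B)` given by the Rota-Baxter words. -/
def wordBasis (b : Module.Basis X K B) : Module.Basis (Σ h : Bool, RBWord X h) K (FreeRB b) :=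
  Module.Basis.ofRepr (LinearEquiv.refl K ((Σ h : Bool, RBWord X h) →₀ K))

/-- The product `⋄`, the bilinear extension of the product of words. -/
def mul (b : Module.Basis X K B) : FreeRB b →ₗ[K] FreeRB b →ₗ[K] FreeRB b :=
  (wordBasis b).constr K fun x => (wordBasis b).constr K fun y =>
    (RBWord.mul b x.2 y.2).sum fun w c => c • wordBasis b ⟨x.1, w⟩

/-- The operator `R_B`, the linear extension of `x ↦ ⌊x⌋`. -/
def op (b : Module.Basis X K B) : FreeRB b →ₗ[K] FreeRB b :=
  (wordBasis b).constr K fun x => wordBasis b ⟨true, .brak x.2⟩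

/-- The inclusion `j_B : B → ϖ^{NC,0}(B)`, the linear extension of the inclusion of `X`. -/
def incl (b : Module.Basis X K B) : B →ₗ[K] FreeRB b :=
  b.constr K fun x => wordBasis b ⟨false, .var x⟩

/-- The involution on words induced by an involution `σ` of `B`: `x ↦ σ x` for `x ∈ X`,
`⌊u⌋* = ⌊u*⌋` and `(x₁ ⋯ xₙ)* = xₙ* ⋯ x₁*`. In the products on the right `⋄` is concatenation
because letters of the two kinds alternate. -/
def wordStar (b : Module.Basis X K B) (σ : B →ₗ[K] B) : {h : Bool} → RBWord X h → FreeRB b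
  | _, .var x => incl b (σ (b x))
  | _, .brak u => op b (wordStar b σ u)
  | _, .varCons x w => mul b (wordStar b σ w) (incl b (σ (b x)))
  | _, .brakCons u w => mul b (wordStar b σ w) (op b (wordStar b σ u))

/-- The involution on `ϖ^{NC,0}(B)` induced by an involution `σ` of `B`. -/
def inv (b : Module.Basis X K B) (σ : B →ₗ[K] B) : FreeRB b →ₗ[K] FreeRB b :=
  (wordBasis b).constr K fun x => wordStar b σ x.2

end FreeRB

end FreeRB

/-! ### The nonunitary tensor algebra -/

section RedTensor

variable (K : Type*) {D : Type*} [Field K] [AddCommGroup D] [Module K D]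

/-- `T(D) = ⨁_{n ≥ 1} D^{⊗ n}`, as the nonunitary subalgebra of the unital tensor algebra that is
generated by `D`. -/
abbrev RedTensor (D : Type*) [AddCommGroup D] [Module K D] :
    NonUnitalSubalgebra K (TensorAlgebra K D) :=
  NonUnitalAlgebra.adjoin K (Set.range (TensorAlgebra.ι K : D → TensorAlgebra K D))

/-- The inclusion `D → T(D)`. -/
def RedTensor.incl : D →ₗ[K] RedTensor K D :=
  (TensorAlgebra.ι K).codRestrict (RedTensor K D).toSubmodule
    fun x => NonUnitalAlgebra.subset_adjoin K ⟨x, rfl⟩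

variable {K}

/-- The linear map of the unital tensor algebra with
`v₁ ⊗ ⋯ ⊗ vₙ ↦ vₙ* ⊗ ⋯ ⊗ v₁*`. -/
def tensorStar (str : D →ₗ[K] D) : TensorAlgebra K D →ₗ[K] TensorAlgebra K D :=
  (MulOpposite.opLinearEquiv K).symm.toLinearMap ∘ₗ
    (TensorAlgebra.lift K
      ((MulOpposite.opLinearEquiv K).toLinearMap ∘ₗ TensorAlgebra.ι K ∘ₗ str)).toLinearMap

theorem tensorStar_ι (str : D →ₗ[K] D) (v : D) :
    tensorStar str (TensorAlgebra.ι K v) = TensorAlgebra.ι K (str v) := by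
  simp [tensorStar]

theorem tensorStar_mul (str : D →ₗ[K] D) (a b : TensorAlgebra K D) :
    tensorStar str (a * b) = tensorStar str b * tensorStar str a := by
  simp [tensorStar]

theorem tensorStar_mem (str : D →ₗ[K] D) (a : TensorAlgebra K D) (ha : a ∈ RedTensor K D) :
    tensorStar str a ∈ RedTensor K D := by
  induction ha using NonUnitalAlgebra.adjoin_induction with
  | mem x hx =>
    obtain ⟨v, rfl⟩ := hx
    rw [tensorStar_ι]
    exact NonUnitalAlgebra.subset_adjoin K ⟨_, rfl⟩
  | add x y _ _ hx hy => rw [map_add]; exact add_mem hx hy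
  | zero => rw [map_zero]; exact zero_mem _
  | mul x y _ _ hx hy => rw [tensorStar_mul]; exact mul_mem hy hx
  | smul r x _ hx => rw [map_smul]; exact SMulMemClass.smul_mem r hx

/-- The involution `(v₁ ⊗ ⋯ ⊗ vₙ)* = vₙ* ⊗ ⋯ ⊗ v₁*` of `T(D)`. -/
def RedTensor.inv (str : D →ₗ[K] D) : RedTensor K D →ₗ[K] RedTensor K D :=
  (tensorStar str).restrict (p := (RedTensor K D).toSubmodule)
    (q := (RedTensor K D).toSubmodule) (tensorStar_mem str)

end RedTensor

/-! ### The universal enveloping Rota-Baxter algebra of a dendriform algebra -/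

section Enveloping

variable {K D X : Type*} [Field K] [AddCommGroup D] [Module K D]

/-- The inclusion `D → T(D) → ϖ^{NC,0}(T(D))`. -/
def dendIncl (b : Module.Basis X K (RedTensor K D)) : D →ₗ[K] FreeRB b :=
  FreeRB.incl b ∘ₗ RedTensor.incl K

/-- The generators `x ≺ y - x⌊y⌋` and `x ≻ y - ⌊x⌋y`, for `x, y ∈ D`. -/
def envelopingRel (b : Module.Basis X K (RedTensor K D)) (prec succ : D →ₗ[K] D →ₗ[K] D) :
    Set (FreeRB b) :=
  {z | ∃ x y : D,
    z = dendIncl b (prec x y) - FreeRB.mul b (dendIncl b x) (FreeRB.op b (dendIncl b y)) ∨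
    z = dendIncl b (succ x y) - FreeRB.mul b (FreeRB.op b (dendIncl b x)) (dendIncl b y)}

/-- The Rota-Baxter ideal `J_R` of `ϖ^{NC,0}(T(D))`. -/
def envelopingIdeal (b : Module.Basis X K (RedTensor K D)) (prec succ : D →ₗ[K] D →ₗ[K] D) :
    Submodule K (FreeRB b) :=
  rotaBaxterIdealSpan (FreeRB.mul b) (FreeRB.op b) (envelopingRel b prec succ)

/-- The universal enveloping Rota-Baxter algebra `ϖ^{NC,0}(T(D)) / J_R`. -/
abbrev Enveloping (b : Module.Basis X K (RedTensor K D)) (prec succ : D →ₗ[K] D →ₗ[K] D) :=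
  FreeRB b ⧸ envelopingIdeal b prec succ

/-- The product of the universal enveloping Rota-Baxter algebra. -/
def Enveloping.mul (b : Module.Basis X K (RedTensor K D)) (prec succ : D →ₗ[K] D →ₗ[K] D) :
    Enveloping b prec succ →ₗ[K] Enveloping b prec succ →ₗ[K] Enveloping b prec succ :=
  quotientMul (isRotaBaxterIdeal_span (FreeRB.mul b) (FreeRB.op b) (envelopingRel b prec succ))

/-- The operator of the universal enveloping Rota-Baxter algebra. -/
def Enveloping.op (b : Module.Basis X K (RedTensor K D)) (prec succ : D →ₗ[K] D →ₗ[K] D) :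
    Enveloping b prec succ →ₗ[K] Enveloping b prec succ :=
  quotientOp (isRotaBaxterIdeal_span (FreeRB.mul b) (FreeRB.op b) (envelopingRel b prec succ))

end Enveloping

end

/-! Everything rests on cutting words into letters. A letter times a word beginning with the other
kind of letter is a concatenation. Two letters of the same kind multiply to a combination of letters
of that kind, which may again be concatenated with what follows (`letter_mul_mul`, `mul_letter_mul`,
`letter_mul_letter_mem`). These rules hold essentially by definition of `⋄`, and with induction on
size they reduce associativity to three letters of the same kind. There it is associativity of `B`,
or the identity showing that both bracketings of `⌊u⌋⌊v⌋⌊w⌋` expand by the Rota-Baxter relation into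
the same three terms (`word_mul_assoc`).

Since `*` reverses concatenations by definition, the same cutting reduces anti-multiplicativity to
two letters of the same kind, where the Rota-Baxter relation is symmetric under reversal
(`inv_word_mul_word`).

For the quotient, `*` exchanges the two families of generators: `(x ≺ y - x⌊y⌋)* = y* ≻ x* -
⌊y*⌋x*`. The preimage of `J_R` under `*` is therefore a Rota-Baxter ideal containing all generators,
hence contains `J_R`, and `*` descends. -/

namespace FreeRB

/-! ### The product of words as identities between linear maps -/

section Product

variable {K B X : Type*} [Field K] [NonUnitalRing B] [Module K B] (b : Module.Basis X K B)

/-- The Rota-Baxter word `w` as an element of `FreeRB b`. -/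
noncomputable abbrev word {h : Bool} (w : RBWord X h) : FreeRB b := wordBasis b ⟨h, w⟩

/-- The inclusion of the linear combinations of words with head `h`. -/
noncomputable def ofHead (h : Bool) : (RBWord X h →₀ K) →ₗ[K] FreeRB b :=
  Finsupp.linearCombination K fun w => word b w

@[simp]
theorem ofHead_single {h : Bool} (w : RBWord X h) : ofHead b h (.single w 1) = word b w := by
  simp [ofHead]

theorem word_mul_word {h h' : Bool} (x : RBWord X h) (y : RBWord X h') :
    mul b (word b x) (word b y) = ofHead b h (RBWord.mul b x y) := by
  simp only [mul, word, Module.Basis.constr_basis]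
  rfl

@[simp]
theorem op_word {h : Bool} (w : RBWord X h) : op b (word b w) = word b (.brak w) := by
  simp [op, word]

@[simp]
theorem incl_basis (x : X) : incl b (b x) = word b (.var x) := by
  simp [incl, word]

/-- Translates the recursion of `RBWord.mul`, phrased through `Finsupp.mapDomain`, into linear maps
such as `op b` or multiplication by a fixed word. -/
theorem ofHead_mapDomain {h h' : Bool} (f : RBWord X h → RBWord X h')
    (g : FreeRB b →ₗ[K] FreeRB b) (hg : ∀ w, g (word b w) = word b (f w)) (m : RBWord X h →₀ K) :
    ofHead b h' (m.mapDomain f) = g (ofHead b h m) := by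
  induction m using Finsupp.induction_linear with
  | zero => simp
  | add m n hm hn => simp [Finsupp.mapDomain_add, hm, hn]
  | single w c => simp [ofHead, hg]

theorem ofHead_mapDomain_of_basis {h : Bool} (f : X → RBWord X h)
    (g : B →ₗ[K] FreeRB b) (hg : ∀ x, g (b x) = word b (f x)) (a : B) :
    ofHead b h ((b.repr a).mapDomain f) = g a := by
  conv_rhs => rw [← b.linearCombination_repr a]
  generalize b.repr a = m
  induction m using Finsupp.induction_linear with
  | zero => simp
  | add m n hm hn => simp [Finsupp.mapDomain_add, hm, hn]
  | single w c => simp [ofHead, hg]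

theorem var_mul_word (x : X) (w : RBWord X true) :
    mul b (word b (.var x)) (word b w) = word b (.varCons x w) := by
  rw [word_mul_word, RBWord.mul, ofHead_single]

theorem brak_mul_word {h : Bool} (u : RBWord X h) (w : RBWord X false) :
    mul b (word b (.brak u)) (word b w) = word b (.brakCons u w) := by
  rw [word_mul_word, RBWord.mul, ofHead_single]

theorem varCons_mul (x : X) (w : RBWord X true) (a : FreeRB b) :
    mul b (word b (.varCons x w)) a = mul b (word b (.var x)) (mul b (word b w) a) := by
  suffices mul b (word b (.varCons x w)) = mul b (word b (.var x)) ∘ₗ mul b (word b w) from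
    congr($this a)
  refine (wordBasis b).ext fun ⟨h, y⟩ => ?_
  change mul b _ (word b y) = mul b _ (mul b _ (word b y))
  rw [word_mul_word, word_mul_word, RBWord.mul]
  exact ofHead_mapDomain b _ _ (var_mul_word b x) _

theorem brakCons_mul {h : Bool} (u : RBWord X h) (w : RBWord X false) (a : FreeRB b) :
    mul b (word b (.brakCons u w)) a = mul b (word b (.brak u)) (mul b (word b w) a) := by
  suffices mul b (word b (.brakCons u w)) = mul b (word b (.brak u)) ∘ₗ mul b (word b w) from
    congr($this a)
  refine (wordBasis b).ext fun ⟨h, y⟩ => ?_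
  change mul b _ (word b y) = mul b _ (mul b _ (word b y))
  rw [word_mul_word, word_mul_word, RBWord.mul]
  exact ofHead_mapDomain b _ _ (brak_mul_word b u) _

theorem var_mul_var (x y : X) :
    mul b (word b (.var x)) (word b (.var y)) = incl b (b x * b y) := by
  rw [word_mul_word, RBWord.mul]
  exact ofHead_mapDomain_of_basis b _ _ (incl_basis b) _

theorem var_mul_varCons (x y : X) (w : RBWord X true) :
    mul b (word b (.var x)) (word b (.varCons y w)) = mul b (incl b (b x * b y)) (word b w) := by
  rw [word_mul_word, RBWord.mul]
  exact ofHead_mapDomain_of_basis b _ ((mul b).flip (word b w) ∘ₗ incl b)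
    (fun z => by simp [var_mul_word]) _

theorem brak_mul_brak {h h' : Bool} (u : RBWord X h) (v : RBWord X h') :
    mul b (word b (.brak u)) (word b (.brak v)) =
      op b (mul b (word b u) (word b (.brak v)) + mul b (word b (.brak u)) (word b v)) := by
  rw [word_mul_word, RBWord.mul, map_add, map_add, word_mul_word, word_mul_word,
    ofHead_mapDomain b _ _ (fun w => op_word b w), ofHead_mapDomain b _ _ (fun w => op_word b w),
    add_comm]

/-- `⌊u⌋ ⋄ ⌊v⌋` is a combination of single brackets, so appending `w`, which begins with an element
of `X`, is concatenation in each term. -/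
theorem brak_mul_brakCons {h h' : Bool} (u : RBWord X h) (v : RBWord X h') (w : RBWord X false) :
    mul b (word b (.brak u)) (word b (.brakCons v w)) =
      mul b (mul b (word b (.brak u)) (word b (.brak v))) (word b w) := by
  have key {k : Bool} (z : RBWord X k) :
      ((mul b).flip (word b w) ∘ₗ op b) (word b z) = word b (.brakCons z w) := by
    simp [brak_mul_word]
  rw [brak_mul_brak, word_mul_word, RBWord.mul, map_add, word_mul_word, word_mul_word,
    ofHead_mapDomain b _ _ key, ofHead_mapDomain b _ _ key, add_comm (ofHead b h _)]
  simp

/-- The span of the words with head `h`. -/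
noncomputable def headSpan (h : Bool) : Submodule K (FreeRB b) :=
  Submodule.span K (Set.range fun w : RBWord X h => word b w)

/-- The span of the one-letter words with head `h`. -/
noncomputable def letterSpan : Bool → Submodule K (FreeRB b)
  | false => LinearMap.range (incl b)
  | true => LinearMap.range (op b)

variable {b}

theorem word_mem_headSpan {h : Bool} (w : RBWord X h) : word b w ∈ headSpan b h :=
  Submodule.subset_span ⟨w, rfl⟩

theorem incl_mem (a : B) : incl b a ∈ letterSpan b false := ⟨a, rfl⟩

theorem op_mem (a : FreeRB b) : op b a ∈ letterSpan b true := ⟨a, rfl⟩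

theorem induction_word {p : FreeRB b → Prop} (hw : ∀ {h : Bool} (w : RBWord X h), p (word b w))
    (zero : p 0) (add : ∀ x y, p x → p y → p (x + y)) (smul : ∀ (c : K) x, p x → p (c • x))
    (a : FreeRB b) : p a := by
  have ha : a ∈ Submodule.span K (Set.range (wordBasis b)) := by
    rw [(wordBasis b).span_eq]; trivial
  induction ha using Submodule.span_induction with
  | mem x hx => obtain ⟨⟨h, w⟩, rfl⟩ := hx; exact hw w
  | zero => exact zero
  | add x y _ _ hx hy => exact add x y hx hy
  | smul c x _ hx => exact smul c x hx

/-- Two linear maps agree on letters with head `h` if they agree on one-letter words. -/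
theorem ext_letterSpan {M : Type*} [AddCommGroup M] [Module K M] {f g : FreeRB b →ₗ[K] M}
    {h : Bool} (hvar : ∀ x, h = false → f (word b (.var x)) = g (word b (.var x)))
    (hbrak : ∀ {k : Bool} (u : RBWord X k), h = true →
      f (word b (.brak u)) = g (word b (.brak u)))
    {l : FreeRB b} (hl : l ∈ letterSpan b h) : f l = g l := by
  cases h with
  | false =>
    obtain ⟨a, rfl⟩ := hl
    suffices f ∘ₗ incl b = g ∘ₗ incl b from congr($this a)
    exact b.ext fun x => by simpa using hvar x rfl
  | true =>
    obtain ⟨a, rfl⟩ := hl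
    suffices f ∘ₗ op b = g ∘ₗ op b from congr($this a)
    refine (wordBasis b).ext fun ⟨k, u⟩ => ?_
    change f (op b (word b u)) = g (op b (word b u))
    rw [op_word, hbrak u rfl]

theorem ext_headSpan {M : Type*} [AddCommGroup M] [Module K M] {f g : FreeRB b →ₗ[K] M}
    {h : Bool} (hw : ∀ w : RBWord X h, f (word b w) = g (word b w))
    {z : FreeRB b} (hz : z ∈ headSpan b h) : f z = g z :=
  LinearMap.eqOn_span (by rintro _ ⟨w, rfl⟩; exact hw w) hz

theorem mul_mem_headSpan {h : Bool} {z : FreeRB b} (hz : z ∈ headSpan b h) (a : FreeRB b) :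
    mul b z a ∈ headSpan b h := by
  -- Modulo `headSpan b h`, membership becomes an equality of linear maps, to which `ext_headSpan`
  -- applies.
  suffices ((headSpan b h).mkQ ∘ₗ (mul b).flip a) z = (0 : FreeRB b →ₗ[K] _) z by
    simpa [Submodule.Quotient.mk_eq_zero] using this
  refine ext_headSpan (fun w => ?_) hz
  suffices mul b (word b w) a ∈ headSpan b h by simpa
  induction a using induction_word with
  | hw y =>
    rw [word_mul_word, ofHead, Finsupp.linearCombination_apply]
    exact Submodule.sum_mem _ fun _ _ => Submodule.smul_mem _ _ (word_mem_headSpan _)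
  | zero => simp
  | add x y hx hy => rw [map_add]; exact add_mem hx hy
  | smul c x hx => rw [map_smul]; exact Submodule.smul_mem _ _ hx

/-- Concatenating a letter with a word that begins with a letter of the other kind. -/
theorem letter_mul_mul {h : Bool} {l z : FreeRB b} (hl : l ∈ letterSpan b h)
    (hz : z ∈ headSpan b (!h)) (c : FreeRB b) : mul b (mul b l z) c = mul b l (mul b z c) := by
  -- Both sides are linear in `l` and in `z`: `key` reduces `z` to a word, `ext_letterSpan` reduces
  -- `l` to a one-letter word.
  have key (l : FreeRB b) (hl : ∀ w : RBWord X (!h),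
      mul b (mul b l (word b w)) c = mul b l (mul b (word b w) c)) :
      mul b (mul b l z) c = mul b l (mul b z c) :=
    ext_headSpan (f := (mul b).flip c ∘ₗ mul b l) (g := mul b l ∘ₗ (mul b).flip c) hl hz
  refine ext_letterSpan (f := (mul b).flip c ∘ₗ (mul b).flip z) (g := (mul b).flip (mul b z c))
    (fun x hx => ?_) (fun u hu => ?_) hl
  · subst hx
    simp only [LinearMap.comp_apply, LinearMap.flip_apply]
    exact key _ fun w => by rw [var_mul_word, varCons_mul]; rfl
  · subst hu
    simp only [LinearMap.comp_apply, LinearMap.flip_apply]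
    exact key _ fun w => by rw [brak_mul_word, brakCons_mul]; rfl

/-- The recursion changes only the two letters that meet; the remainder `z` of the second factor is
carried along unchanged. -/
theorem mul_letter_mul {h : Bool} {l l' z : FreeRB b} (hl : l ∈ letterSpan b h)
    (hl' : l' ∈ letterSpan b h) (hz : z ∈ headSpan b (!h)) :
    mul b (mul b l l') z = mul b l (mul b l' z) := by
  have key (l l' : FreeRB b) (hl : ∀ w : RBWord X (!h),
      mul b (mul b l l') (word b w) = mul b l (mul b l' (word b w))) :
      mul b (mul b l l') z = mul b l (mul b l' z) :=
    ext_headSpan (f := mul b (mul b l l')) (g := mul b l ∘ₗ mul b l') hl hz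
  refine ext_letterSpan (f := (mul b).flip z ∘ₗ (mul b).flip l') (g := (mul b).flip (mul b l' z))
    (fun x hx => ?_) (fun u hu => ?_) hl
  · refine ext_letterSpan (f := (mul b).flip z ∘ₗ mul b (word b (.var x)))
      (g := mul b (word b (.var x)) ∘ₗ (mul b).flip z)
      (fun y hy => ?_) (fun v hv => by simp [hx] at hv) hl'
    subst hx
    simp only [LinearMap.comp_apply, LinearMap.flip_apply]
    exact key _ _ fun w => by rw [var_mul_var, var_mul_word, var_mul_varCons]; rfl
  · refine ext_letterSpan (f := (mul b).flip z ∘ₗ mul b (word b (.brak u)))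
      (g := mul b (word b (.brak u)) ∘ₗ (mul b).flip z)
      (fun y hy => by simp [hu] at hy) (fun v hv => ?_) hl'
    subst hu
    simp only [LinearMap.comp_apply, LinearMap.flip_apply]
    exact key _ _ fun w => by rw [brak_mul_word, brak_mul_brakCons]; rfl

theorem op_mul_op (a a' : FreeRB b) :
    mul b (op b a) (op b a') = op b (mul b a (op b a') + mul b (op b a) a') := by
  induction a using induction_word with
  | zero => simp
  | add x y hx hy => simp only [map_add, LinearMap.add_apply, hx, hy]; abel
  | smul c x hx => simp only [map_smul, LinearMap.smul_apply, hx, ← smul_add]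
  | hw u =>
    induction a' using induction_word with
    | zero => simp
    | add x y hx hy => simp only [map_add, hx, hy]; abel
    | smul c x hx => simp only [map_smul, hx, ← smul_add]
    | hw v => simp only [op_word]; exact brak_mul_brak b u v

theorem incl_mul_incl [IsScalarTower K B B] [SMulCommClass K B B] (a a' : B) :
    mul b (incl b a) (incl b a') = incl b (a * a') := by
  suffices (mul b).compl₁₂ (incl b) (incl b) = (LinearMap.mul K B).compr₂ (incl b) from
    congr($this a a')
  exact b.ext fun x => b.ext fun y => by simp [var_mul_var]

/-- Allows the concatenation rules to be applied again with a product of two letters in place of a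
letter. -/
theorem letter_mul_letter_mem [IsScalarTower K B B] [SMulCommClass K B B] {h : Bool}
    {l l' : FreeRB b} (hl : l ∈ letterSpan b h)
    (hl' : l' ∈ letterSpan b h) : mul b l l' ∈ letterSpan b h := by
  cases h with
  | false =>
    obtain ⟨a, rfl⟩ := hl
    obtain ⟨a', rfl⟩ := hl'
    rw [incl_mul_incl]
    exact incl_mem _
  | true =>
    obtain ⟨a, rfl⟩ := hl
    obtain ⟨a', rfl⟩ := hl'
    rw [op_mul_op]
    exact op_mem _

end Product

end FreeRB

/-- A Rota-Baxter word with exactly one letter. -/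
inductive RBWord.IsLetter {X : Type*} : {h : Bool} → RBWord X h → Prop
  | var (x : X) : IsLetter (.var x)
  | brak {h : Bool} (u : RBWord X h) : IsLetter (.brak u)

namespace FreeRB

/-! ### Associativity of `⋄` -/

section Associativity

variable {K B X : Type*} [Field K] [NonUnitalRing B] [Module K B] {b : Module.Basis X K B}

theorem word_mem_letterSpan {h : Bool} {l : RBWord X h} (hl : l.IsLetter) :
    word b l ∈ letterSpan b h := by
  cases hl with
  | var x => exact ⟨b x, incl_basis b x⟩
  | brak u => exact ⟨word b u, op_word b u⟩

variable (b) in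
/-- A word is either one letter or the product of a letter and a shorter word whose first letter is
of the other kind. -/
theorem word_cases {h : Bool} (w : RBWord X h) :
    w.IsLetter ∨ ∃ (l : RBWord X h) (w' : RBWord X (!h)), l.IsLetter ∧
      sizeOf l < sizeOf w ∧ sizeOf w' < sizeOf w ∧
      word b w = mul b (word b l) (word b w') := by
  cases w with
  | var x => exact .inl (.var x)
  | brak u => exact .inl (.brak u)
  | varCons x w =>
    exact .inr ⟨_, w, .var x, by cases w <;> simp, by simp, (var_mul_word b x w).symm⟩
  | brakCons u w =>
    exact .inr ⟨_, w, .brak u, by cases w <;> simp, by simp,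
      (brak_mul_word b u w).symm⟩

variable [IsScalarTower K B B] [SMulCommClass K B B]

/-- Induction on total size. If adjacent factors meet in letters of different kinds, or if `y` has
several letters, the two products do not interact once `x` is a letter. Otherwise long outer factors
are shortened until three letters of one kind remain. -/
theorem word_mul_assoc {h h' h'' : Bool} (x : RBWord X h) (y : RBWord X h') (z : RBWord X h'') :
    mul b (mul b (word b x) (word b y)) (word b z) =
      mul b (word b x) (mul b (word b y) (word b z)) := by
  induction hn : sizeOf x + sizeOf y + sizeOf z using Nat.strong_induction_on
    generalizing h h' h'' with
  | _ n ih =>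
  subst hn
  obtain hx | ⟨l, x', hl, -, hlt, hx⟩ := word_cases b x
  · obtain rfl | rfl : h' = !h ∨ h' = h := by cases h <;> cases h' <;> simp
    · exact letter_mul_mul (word_mem_letterSpan hx) (word_mem_headSpan y) _
    replace hx' := word_mem_letterSpan (b := b) hx
    obtain hy | ⟨l, y', hl, -, -, hy⟩ := word_cases b y
    · have hy' := word_mem_letterSpan (b := b) hy
      obtain rfl | rfl : h'' = !h' ∨ h'' = h' := by cases h'' <;> cases h' <;> simp
      · exact mul_letter_mul hx' hy' (word_mem_headSpan z)
      obtain hz | ⟨l, z', hl, hlt, -, hz⟩ := word_cases b z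
      · cases hx with
        | var x =>
          cases hy with | var y =>
          cases hz with | var z =>
          simp only [← incl_basis, incl_mul_incl, mul_assoc]
        | brak u =>
          cases hy with | brak v =>
          cases hz with | brak w =>
          have h₁ := ih _ (by simp) u (.brak v) (.brak w) rfl
          have h₂ := ih _ (by simp) (.brak u) v (.brak w) rfl
          have h₃ := ih _ (by simp) (.brak u) (.brak v) w rfl
          simp only [← op_word] at h₁ h₂ h₃ ⊢
          -- After expanding both products, the inner operator terms are folded back into `⌊u⌋⌊v⌋`
          -- and `⌊v⌋⌊w⌋`; what remains under the outer `op b` matches termwise by `h₁`, `h₂`, `h₃`.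
          rw [op_mul_op (word b u), op_mul_op (word b v), op_mul_op, op_mul_op,
            ← op_mul_op (word b u), ← op_mul_op (word b v)]
          simp only [map_add, LinearMap.add_apply, h₁, h₂, h₃]
          abel
      · have hl' := word_mem_letterSpan (b := b) hl
        have hz' := word_mem_headSpan (b := b) z'
        -- Only the first letter `l` of `z` meets `x` and `y`; the tail `z'` is split off and the
        -- induction hypothesis is used for `x`, `y`, `l`.
        rw [hz, ← mul_letter_mul (letter_mul_letter_mem hx' hy') hl' hz',
          ih _ (by omega) x y l rfl, mul_letter_mul hx' (letter_mul_letter_mem hy' hl') hz',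
          mul_letter_mul hy' hl' hz']
    · have hl' := word_mem_letterSpan (b := b) hl
      have hy' := word_mem_headSpan (b := b) y'
      -- The tail `y'` separates `x` from `z`, so no induction hypothesis is needed.
      rw [hy, ← mul_letter_mul hx' hl' hy', letter_mul_mul (letter_mul_letter_mem hx' hl') hy',
        letter_mul_mul hl' hy', mul_letter_mul hx' hl' (mul_mem_headSpan hy' _)]
  · have hl' := word_mem_letterSpan (b := b) hl
    have hx' := word_mem_headSpan (b := b) x'
    rw [hx, letter_mul_mul hl' hx', letter_mul_mul hl' (mul_mem_headSpan hx' _),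
      ih _ (by omega) x' y z rfl, letter_mul_mul hl' hx']

theorem mul_mul_assoc (x y z : FreeRB b) : mul b (mul b x y) z = mul b x (mul b y z) := by
  induction x using induction_word with
  | zero => simp
  | add x x' hx hx' => simp only [map_add, LinearMap.add_apply, hx, hx']
  | smul c x hx => simp only [map_smul, LinearMap.smul_apply, hx]
  | hw x =>
    induction y using induction_word with
    | zero => simp
    | add y y' hy hy' => simp only [map_add, LinearMap.add_apply, hy, hy']
    | smul c y hy => simp only [map_smul, LinearMap.smul_apply, hy]
    | hw y =>
      induction z using induction_word with
      | zero => simp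
      | add z z' hz hz' => simp only [map_add, hz, hz']
      | smul c z hz => simp only [map_smul, hz]
      | hw z => exact word_mul_assoc x y z

variable (b) in
theorem isRotaBaxterAlgebra : IsRotaBaxterAlgebra (mul b) (op b) :=
  ⟨mul_mul_assoc, op_mul_op⟩

end Associativity

/-! ### The involution induced from `B` -/

section Involution

variable {K B X : Type*} [Field K] [NonUnitalRing B] [Module K B] {b : Module.Basis X K B}
  {σ : B →ₗ[K] B}

theorem inv_word {h : Bool} (w : RBWord X h) : inv b σ (word b w) = wordStar b σ w := by
  simp [inv, word]

theorem inv_incl (a : B) : inv b σ (incl b a) = incl b (σ a) := by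
  suffices inv b σ ∘ₗ incl b = incl b ∘ₗ σ from congr($this a)
  exact b.ext fun x => by simp [inv_word, wordStar]

theorem inv_op (a : FreeRB b) : inv b σ (op b a) = op b (inv b σ a) := by
  induction a using induction_word with
  | zero => simp
  | add x y hx hy => simp only [map_add, hx, hy]
  | smul c x hx => simp only [map_smul, hx]
  | hw w => rw [op_word, inv_word, inv_word, wordStar]

/-- For a one-letter word and a word this is the defining clause of `wordStar`; both sides are
linear in `l` and `z`. -/
theorem inv_letter_mul {h : Bool} {l z : FreeRB b} (hl : l ∈ letterSpan b h)
    (hz : z ∈ headSpan b (!h)) :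
    inv b σ (mul b l z) = mul b (inv b σ z) (inv b σ l) := by
  have key (l : FreeRB b) (hl : ∀ w : RBWord X (!h),
      inv b σ (mul b l (word b w)) = mul b (inv b σ (word b w)) (inv b σ l)) :
      inv b σ (mul b l z) = mul b (inv b σ z) (inv b σ l) :=
    ext_headSpan (f := inv b σ ∘ₗ mul b l) (g := (mul b).flip (inv b σ l) ∘ₗ inv b σ) hl hz
  refine ext_letterSpan (f := inv b σ ∘ₗ (mul b).flip z) (g := mul b (inv b σ z) ∘ₗ inv b σ)
    (fun x hx => ?_) (fun u hu => ?_) hl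
  · subst hx
    simp only [LinearMap.comp_apply, LinearMap.flip_apply]
    exact key _ fun w => by rw [var_mul_word]; simp only [inv_word, wordStar]
  · subst hu
    simp only [LinearMap.comp_apply, LinearMap.flip_apply]
    exact key _ fun w => by rw [brak_mul_word]; simp only [inv_word, wordStar]

variable [IsScalarTower K B B] [SMulCommClass K B B]

/-- Tails are split off by associativity and reversed by `inv_letter_mul`. For two brackets,
reversal interchanges the two summands of the Rota-Baxter relation. -/
theorem inv_word_mul_word (hσ : ∀ x y, σ (x * y) = σ y * σ x) {h h' : Bool} (x : RBWord X h)
    (y : RBWord X h') :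
    inv b σ (mul b (word b x) (word b y)) =
      mul b (inv b σ (word b y)) (inv b σ (word b x)) := by
  induction hn : sizeOf x + sizeOf y using Nat.strong_induction_on generalizing h h' with
  | _ n ih =>
  subst hn
  obtain hx | ⟨l, x', hl, -, hlt, hx⟩ := word_cases b x
  · have hx' := word_mem_letterSpan (b := b) hx
    obtain rfl | rfl : h' = !h ∨ h' = h := by cases h <;> cases h' <;> simp
    · exact inv_letter_mul hx' (word_mem_headSpan y)
    obtain hy | ⟨l, y', hl, hlt, -, hy⟩ := word_cases b y
    · cases hx with
      | var x =>
        cases hy with | var y =>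
        simp only [← incl_basis, incl_mul_incl, inv_incl, hσ]
      | brak u =>
        cases hy with | brak v =>
        have h₁ := ih _ (by simp) u (.brak v) rfl
        have h₂ := ih _ (by simp) (.brak u) v rfl
        simp only [← op_word, inv_op] at h₁ h₂ ⊢
        rw [op_mul_op, op_mul_op, inv_op, map_add, h₁, h₂, add_comm]
    · have hl' := word_mem_letterSpan (b := b) hl
      have hy' := word_mem_headSpan (b := b) y'
      rw [hy, ← mul_mul_assoc, inv_letter_mul (letter_mul_letter_mem hx' hl') hy',
        ih _ (by omega) x l rfl, inv_letter_mul hl' hy', mul_mul_assoc]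
  · have hl' := word_mem_letterSpan (b := b) hl
    have hx' := word_mem_headSpan (b := b) x'
    rw [hx, mul_mul_assoc, inv_letter_mul hl' (mul_mem_headSpan hx' _),
      ih _ (by omega) x' y rfl, inv_letter_mul hl' hx', mul_mul_assoc]

theorem inv_mul (hσ : ∀ x y, σ (x * y) = σ y * σ x) (x y : FreeRB b) :
    inv b σ (mul b x y) = mul b (inv b σ y) (inv b σ x) := by
  induction x using induction_word with
  | zero => simp
  | add x x' hx hx' => simp only [map_add, LinearMap.add_apply, hx, hx']
  | smul c x hx => simp only [map_smul, LinearMap.smul_apply, hx]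
  | hw x =>
    induction y using induction_word with
    | zero => simp
    | add y y' hy hy' => simp only [map_add, LinearMap.add_apply, hy, hy']
    | smul c y hy => simp only [map_smul, LinearMap.smul_apply, hy]
    | hw y => exact inv_word_mul_word hσ x y

theorem inv_inv_word (hσ : ∀ x y, σ (x * y) = σ y * σ x) (hσσ : ∀ x, σ (σ x) = x) {h : Bool}
    (w : RBWord X h) : inv b σ (inv b σ (word b w)) = word b w := by
  induction w with
  | var x => rw [← incl_basis, inv_incl, inv_incl, hσσ]
  | brak u ih => rw [← op_word, inv_op, inv_op, ih]
  | varCons x w ih =>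
    rw [← var_mul_word, inv_mul hσ, inv_mul hσ, ih, ← incl_basis, inv_incl, inv_incl, hσσ]
  | brakCons u w ihu ihw =>
    rw [← brak_mul_word, inv_mul hσ, inv_mul hσ, ihw, ← op_word, inv_op, inv_op, ihu]

variable (b) in
/-- An involution of `B` induces an involution of the free Rota-Baxter algebra on `B`. -/
theorem isInvolutiveRotaBaxterAlgebra (hσ : ∀ x y, σ (x * y) = σ y * σ x)
    (hσσ : ∀ x, σ (σ x) = x) : IsInvolutiveRotaBaxterAlgebra (mul b) (op b) (inv b σ) where
  toIsRotaBaxterAlgebra := isRotaBaxterAlgebra b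
  star_star a := by
    induction a using induction_word with
    | zero => simp
    | add x y hx hy => simp only [map_add, hx, hy]
    | smul c x hx => simp only [map_smul, hx]
    | hw w => exact inv_inv_word hσ hσσ w
  star_mul := inv_mul hσ
  star_op := inv_op

end Involution

end FreeRB

/-! ### Rota-Baxter ideals and involutions on quotients -/

section Quotient

variable {K A : Type*} [Field K] [AddCommGroup A] [Module K A] {μ : A →ₗ[K] A →ₗ[K] A}
  {R str : A →ₗ[K] A}

theorem subset_rotaBaxterIdealSpan (S : Set A) : S ⊆ rotaBaxterIdealSpan μ R S := fun x hx => by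
  rw [SetLike.mem_coe, rotaBaxterIdealSpan, Submodule.mem_sInf]
  exact fun I hI => hI.2 hx

theorem rotaBaxterIdealSpan_le {S : Set A} {I : Submodule K A} (hI : IsRotaBaxterIdeal μ R I)
    (hS : S ⊆ I) : rotaBaxterIdealSpan μ R S ≤ I :=
  sInf_le ⟨hI, hS⟩

/-- The preimage of a Rota-Baxter ideal under an involution is a Rota-Baxter ideal. -/
theorem IsRotaBaxterIdeal.comap_star (h : IsInvolutiveRotaBaxterAlgebra μ R str)
    {I : Submodule K A} (hI : IsRotaBaxterIdeal μ R I) :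
    IsRotaBaxterIdeal μ R (I.comap str) where
  mul_left_mem a x hx := by
    rw [Submodule.mem_comap, h.star_mul]
    exact hI.mul_right_mem _ _ hx
  mul_right_mem a x hx := by
    rw [Submodule.mem_comap, h.star_mul]
    exact hI.mul_left_mem _ _ hx
  op_mem x hx := by
    rw [Submodule.mem_comap, h.star_op]
    exact hI.op_mem _ hx

/-- The quotient of an involutive Rota-Baxter algebra by a Rota-Baxter ideal that is stable under
the involution is an involutive Rota-Baxter algebra. -/
theorem IsInvolutiveRotaBaxterAlgebra.quotient (h : IsInvolutiveRotaBaxterAlgebra μ R str)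
    {I : Submodule K A} (hI : IsRotaBaxterIdeal μ R I) (hstr : I ≤ I.comap str) :
    IsInvolutiveRotaBaxterAlgebra (quotientMul hI) (quotientOp hI) (I.mapQ I str hstr) where
  mul_assoc x y z := by
    obtain ⟨x, rfl⟩ := I.mkQ_surjective x
    obtain ⟨y, rfl⟩ := I.mkQ_surjective y
    obtain ⟨z, rfl⟩ := I.mkQ_surjective z
    simp only [quotientMul_mk, h.mul_assoc]
  rotaBaxter x y := by
    obtain ⟨x, rfl⟩ := I.mkQ_surjective x
    obtain ⟨y, rfl⟩ := I.mkQ_surjective y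
    simp only [quotientMul_mk, quotientOp_mk, ← map_add, h.rotaBaxter]
  star_star x := by
    obtain ⟨x, rfl⟩ := I.mkQ_surjective x
    exact congrArg I.mkQ (h.star_star x)
  star_mul x y := by
    obtain ⟨x, rfl⟩ := I.mkQ_surjective x
    obtain ⟨y, rfl⟩ := I.mkQ_surjective y
    exact congrArg I.mkQ (h.star_mul x y)
  star_op x := by
    obtain ⟨x, rfl⟩ := I.mkQ_surjective x
    exact congrArg I.mkQ (h.star_op x)

end Quotient

/-! ### The enveloping algebra of an involutive dendriform algebra -/

section Enveloping

variable {K D X : Type*} [Field K] [AddCommGroup D] [Module K D]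

theorem IsInvolutiveDendriform.star_succ {prec succ : D →ₗ[K] D →ₗ[K] D} {str : D →ₗ[K] D}
    (hD : IsInvolutiveDendriform prec succ str) (x y : D) :
    str (succ x y) = prec (str y) (str x) := by
  have := hD.star_prec (str y) (str x)
  rw [hD.star_star, hD.star_star] at this
  rw [← this, hD.star_star]

theorem RedTensor.inv_mul (str : D →ₗ[K] D) (x y : RedTensor K D) :
    RedTensor.inv str (x * y) = RedTensor.inv str y * RedTensor.inv str x :=
  Subtype.ext (tensorStar_mul str x y)

theorem RedTensor.inv_incl (str : D →ₗ[K] D) (v : D) :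
    RedTensor.inv str (RedTensor.incl K v) = RedTensor.incl K (str v) :=
  Subtype.ext (tensorStar_ι str v)

theorem RedTensor.inv_inv {str : D →ₗ[K] D} (hstr : ∀ v, str (str v) = v) (x : RedTensor K D) :
    RedTensor.inv str (RedTensor.inv str x) = x := by
  obtain ⟨x, hx⟩ := x
  refine Subtype.ext ?_
  change tensorStar str (tensorStar str x) = x
  induction hx using NonUnitalAlgebra.adjoin_induction with
  | mem x hx =>
    obtain ⟨v, rfl⟩ := hx
    rw [tensorStar_ι, tensorStar_ι, hstr]
  | add x y _ _ hx hy => rw [map_add, map_add, hx, hy]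
  | zero => rw [map_zero, map_zero]
  | mul x y _ _ hx hy => rw [tensorStar_mul, tensorStar_mul, hx, hy]
  | smul r x _ hx => rw [map_smul, map_smul, hx]

theorem inv_dendIncl (b : Module.Basis X K (RedTensor K D)) (str : D →ₗ[K] D) (v : D) :
    FreeRB.inv b (RedTensor.inv str) (dendIncl b v) = dendIncl b (str v) := by
  simp only [dendIncl, LinearMap.comp_apply]
  rw [FreeRB.inv_incl, RedTensor.inv_incl]

end Enveloping

theorem mainTheorem7 {K D X : Type*} [Field K] [CharZero K] [AddCommGroup D] [Module K D]
    (prec succ : D →ₗ[K] D →ₗ[K] D) (str : D →ₗ[K] D)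
    (hD : IsInvolutiveDendriform prec succ str)
    (b : Module.Basis X K (RedTensor K D)) :
    IsInvolutiveRotaBaxterAlgebra (FreeRB.mul b) (FreeRB.op b)
        (FreeRB.inv b (RedTensor.inv str)) ∧
      (∀ z ∈ envelopingIdeal b prec succ,
        FreeRB.inv b (RedTensor.inv str) z ∈ envelopingIdeal b prec succ) ∧
      ∃! s : Enveloping b prec succ →ₗ[K] Enveloping b prec succ,
        (∀ z : FreeRB b, s ((envelopingIdeal b prec succ).mkQ z) =
          (envelopingIdeal b prec succ).mkQ (FreeRB.inv b (RedTensor.inv str) z)) ∧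
        IsInvolutiveRotaBaxterAlgebra (Enveloping.mul b prec succ) (Enveloping.op b prec succ)
          s := by
  have hF := FreeRB.isInvolutiveRotaBaxterAlgebra b (RedTensor.inv_mul str)
    (RedTensor.inv_inv hD.star_star)
  have hJ := isRotaBaxterIdeal_span (FreeRB.mul b) (FreeRB.op b) (envelopingRel b prec succ)
  have hstar : envelopingIdeal b prec succ ≤
      (envelopingIdeal b prec succ).comap (FreeRB.inv b (RedTensor.inv str)) := by
    refine rotaBaxterIdealSpan_le (hJ.comap_star hF) ?_
    rintro _ ⟨x, y, rfl | rfl⟩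
    -- Reversal turns a `≺`-generator at `(x, y)` into the `≻`-generator at `(y*, x*)`; the other
    -- case is the converse.
    · refine subset_rotaBaxterIdealSpan _ ⟨str y, str x, .inr ?_⟩
      rw [map_sub, hF.star_mul, hF.star_op]
      simp only [inv_dendIncl, hD.star_prec]
    · refine subset_rotaBaxterIdealSpan _ ⟨str y, str x, .inl ?_⟩
      rw [map_sub, hF.star_mul, hF.star_op]
      simp only [inv_dendIncl, hD.star_succ]
  refine ⟨hF, hstar, Submodule.mapQ _ _ _ hstar, ⟨fun z => rfl, hF.quotient hJ hstar⟩, ?_⟩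
  rintro s ⟨hs, -⟩
  -- The values on classes alone determine `s`, since a linear map on the quotient is determined by
  -- its composite with the projection.
  exact Submodule.linearMap_qext _ (LinearMap.ext hs)
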